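/- Let $k$ be a field and $Q=(Q_0,Q_1,s,t)$ a finite quiver (finitely many vertices and arrows). For $n\ge 2$ let $kQ^c_{\le n}$ be the $n$-truncated path coalgebra: the $k$-vector space with basis the paths of $Q$ of length at most $n$ (trivial paths $e_i$, $i\in Q_0$, included), with $\Delta(p)=\sum_{p=qr} q\otimes r$ (the sum over all ways of writing $p$ as a concatenation of two paths, trivial ones allowed), $\varepsilon(e_i)=1$ and $\varepsilon(p)=0$ for every nontrivial path $p$. For a $k$-coalgebra $C$ let $\operatorname{Aut}(C)$ be the group of coalgebra automorphisms of $C$, and $\operatorname{Aut}_0(C)$ the subgroup of those which restrict to the identity on the coradical of $C$ (the sum of all simple subcoalgebras). Let $\operatorname{Aut}(Q)$ be the group of permutations $\sigma$ of $Q_0$ such that, for all $i,j\in Q_0$, there are as many arrows from $\sigma(i)$ to $\sigma(j)$ as from $i$ to $j$. Call $Q$ Schurian if for all $i,j\in Q_0$ there is at most one arrow from $i$ to $j$. Solvability is meant for abstract groups. (1) Over every field $k$: - $\operatorname{Aut}_0(kQ^c_{\le n})$ is solvable for some $n\ge2$ if and only if it is solvable for all $n\ge 2$, and this is the case if $Q$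 is Schurian; - $\operatorname{Aut}(kQ^c_{\le n})$ is solvable for some $n\ge2$ if and only if it is solvable for all $n\ge 2$; this is the case if $Q$ is Schurian and $\operatorname{Aut}(Q)$ is solvable, and it implies that $\operatorname{Aut}(Q)$ is solvable. (2) If $k$ has more than three elements, then the following equivalences hold: - $\operatorname{Aut}_0(kQ^c_{\le n})$ is solvable for some $n\ge 2$ $\iff$ $Q$ is Schurian $\iff$ $\operatorname{Aut}_0(kQ^c_{\le n})$ is solvable for all $n\ge 2$; - $\operatorname{Aut}(kQ^c_{\le n})$ is solvable for some $n\ge 2$ $\iff$ $Q$ is Schurian and $\operatorname{Aut}(Q)$ is solvable $\iff$ $\operatorname{Aut}(kQ^c_{\le n})$ is solvable for all $n\ge 2$. -/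

import Mathlib

open scoped TensorProduct

/-! ### Coalgebras: subcoalgebras, coradical, automorphism groups -/

section Coalgebra

variable (k : Type*) [Field k] (C : Type*) [AddCommGroup C] [Module k C] [Coalgebra k C]

/-- A subspace `D` of a coalgebra `C` is a subcoalgebra if `Δ(D) ⊆ D ⊗ D`, where `D ⊗ D` is
viewed as a subspace of `C ⊗ C`. -/
def IsSubcoalgebra {C : Type*} [AddCommGroup C] [Module k C] [Coalgebra k C]
    (D : Submodule k C) : Prop :=
  ∀ x ∈ D, Coalgebra.comul (R := k) x ∈
    LinearMap.range (TensorProduct.map D.subtype D.subtype)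

/-- A simple subcoalgebra: a nonzero subcoalgebra whose only subcoalgebras are `0` and itself. -/
def IsSimpleSubcoalgebra {C : Type*} [AddCommGroup C] [Module k C] [Coalgebra k C]
    (D : Submodule k C) : Prop :=
  IsSubcoalgebra k D ∧ D ≠ ⊥ ∧
    ∀ E : Submodule k C, IsSubcoalgebra k E → E ≤ D → E = ⊥ ∨ E = D

/-- The coradical `C₍₀₎`: the sum of all simple subcoalgebras of `C`. -/
def coradical : Submodule k C :=
  sSup {D : Submodule k C | IsSimpleSubcoalgebra k D}

/-- `Aut(C)`: the coalgebra automorphisms of `C` form a group under composition. -/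
instance coalgAutGroup : Group (C ≃ₗc[k] C) where
  mul f g := g.trans f
  one := CoalgEquiv.refl k C
  inv f := f.symm
  mul_assoc _ _ _ := rfl
  one_mul _ := rfl
  mul_one _ := rfl
  inv_mul_cancel f := by
    apply DFunLike.ext
    exact fun x => f.toLinearEquiv.symm_apply_apply x

/-- `Aut₀(C)`: the automorphisms of `C` which restrict to the identity on the coradical. -/
def coalgAutZero : Subgroup (C ≃ₗc[k] C) where
  carrier := {f | ∀ x ∈ coradical k C, f x = x}
  one_mem' := fun _ _ => rfl
  mul_mem' := by
    intro f g hf hg x hx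
    change f (g x) = x
    rw [hg x hx, hf x hx]
  inv_mem' := by
    intro f hf x hx
    change f.toLinearEquiv.symm x = x
    rw [LinearEquiv.symm_apply_eq]
    exact (hf x hx).symm

end Coalgebra

/-! ### Quivers -/

section Quiver

variable (V : Type*) [Quiver V]

/-- The automorphism group of a quiver: the permutations `σ` of the vertices such that there are
as many arrows from `σ s` to `σ t` as from `s` to `t`, for all vertices `s`, `t`. -/
def quiverAut : Subgroup (Equiv.Perm V) where
  carrier := {σ | ∀ s t : V, Nonempty ((s ⟶ t) ≃ (σ s ⟶ σ t))}
  one_mem' := fun _ _ => ⟨Equiv.refl _⟩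
  mul_mem' := by
    intro σ τ hσ hτ s t
    exact ⟨(hτ s t).some.trans (hσ (τ s) (τ t)).some⟩
  inv_mem' := by
    intro σ hσ s t
    have e := (hσ (σ⁻¹ s) (σ⁻¹ t)).some
    have h : ∀ x, σ (σ⁻¹ x) = x := σ.apply_symm_apply
    rw [h, h] at e
    exact ⟨e.symm⟩

/-- A quiver is Schurian if there is at most one arrow from `s` to `t`, for all vertices `s`, `t`. -/
def IsSchurian : Prop := ∀ s t : V, Subsingleton (s ⟶ t)

/-- The paths of length at most `n` (trivial paths included). -/
structure TruncPath (n : ℕ) where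
  /-- the starting vertex -/
  src : V
  /-- the terminating vertex -/
  tgt : V
  /-- the path itself -/
  path : Quiver.Path src tgt
  /-- the bound on the length -/
  length_le : path.length ≤ n

end Quiver

section Splits

variable {V : Type*} [Quiver V]

/-- The list of all the ways to write a path `p` as a concatenation `q r` of two paths, trivial
paths being allowed: a path of length `m` has `m + 1` of them. -/
def pathSplits {a : V} : ∀ {b : V}, Quiver.Path a b →
    List (Σ c : V, Quiver.Path a c × Quiver.Path c b)
  | _, .nil => [⟨a, .nil, .nil⟩]
  | b, .cons p e =>
      (pathSplits p).map (fun s => ⟨s.1, s.2.1, s.2.2.cons e⟩) ++ [⟨b, p.cons e, .nil⟩]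

theorem length_add_of_mem_pathSplits {a b : V} (p : Quiver.Path a b)
    (s : Σ c : V, Quiver.Path a c × Quiver.Path c b) (hs : s ∈ pathSplits p) :
    s.2.1.length + s.2.2.length = p.length := by
  induction p with
  | nil =>
    simp only [pathSplits, List.mem_singleton] at hs
    subst hs
    rfl
  | cons p e ih =>
    simp only [pathSplits, List.mem_append, List.mem_map, List.mem_singleton] at hs
    rcases hs with ⟨t, ht, rfl⟩ | rfl
    · have := ih t ht
      simp only [Quiver.Path.length_cons]
      omega
    · simp

/-- Splitting the left part again or splitting the right part again gives the same triples. -/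
theorem sum_pathSplits_assoc {M : Type*} [AddCommMonoid M] {a b : V} (p : Quiver.Path a b)
    (F : ∀ c d : V, Quiver.Path a c → Quiver.Path c d → Quiver.Path d b → M) :
    ((pathSplits p).map fun s =>
      ((pathSplits s.2.1).map fun t => F t.1 s.1 t.2.1 t.2.2 s.2.2).sum).sum =
    ((pathSplits p).map fun s =>
      ((pathSplits s.2.2).map fun t => F s.1 t.1 s.2.1 t.2.1 t.2.2).sum).sum := by
  induction p with
  | nil => simp [pathSplits]
  | cons p e ih =>
    have h := ih (fun c d q r s => F c d q r (s.cons e))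
    simp only [pathSplits, List.map_append, List.map_map, List.map_cons, List.map_nil,
      List.sum_append, List.sum_cons, List.sum_nil, add_zero, Function.comp_def,
      List.sum_map_add] at h ⊢
    rw [h, add_assoc]

/-- The only splitting of `p` with a trivial left part is `e_{s(p)} p`. -/
theorem sum_pathSplits_left {M : Type*} [AddCommMonoid M] {a b : V} (p : Quiver.Path a b)
    (F : ∀ c : V, Quiver.Path a c → Quiver.Path c b → M)
    (h0 : ∀ (c : V) (q : Quiver.Path a c) (r : Quiver.Path c b), q.length ≠ 0 → F c q r = 0) :
    ((pathSplits p).map fun s => F s.1 s.2.1 s.2.2).sum = F a .nil p := by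
  induction p with
  | nil => simp [pathSplits]
  | cons p e ih =>
    have h := ih (fun c q r => F c q (r.cons e)) (fun c q r hq => h0 c q _ hq)
    simp only [pathSplits, List.map_append, List.map_map, List.map_cons, List.map_nil,
      List.sum_append, List.sum_cons, List.sum_nil, add_zero, Function.comp_def] at h ⊢
    rw [h, h0 _ (p.cons e) _ (by simp), add_zero]

/-- The only splitting of `p` with a trivial right part is `p e_{t(p)}`. -/
theorem sum_pathSplits_right {M : Type*} [AddCommMonoid M] {a b : V} (p : Quiver.Path a b)
    (F : ∀ c : V, Quiver.Path a c → Quiver.Path c b → M)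
    (h0 : ∀ (c : V) (q : Quiver.Path a c) (r : Quiver.Path c b), r.length ≠ 0 → F c q r = 0) :
    ((pathSplits p).map fun s => F s.1 s.2.1 s.2.2).sum = F b p .nil := by
  cases p with
  | nil => simp [pathSplits]
  | cons p e =>
    simp only [pathSplits, List.map_append, List.map_map, List.map_cons, List.map_nil,
      List.sum_append, List.sum_cons, List.sum_nil, add_zero, Function.comp_def]
    have : ((pathSplits p).map fun s => F s.1 s.2.1 (s.2.2.cons e)).sum = 0 := by
      apply List.sum_eq_zero
      intro x hx
      obtain ⟨s, -, rfl⟩ := List.mem_map.1 hx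
      exact h0 _ _ _ (by simp)
    rw [this, zero_add]

end Splits

/-! ### The truncated path coalgebra -/

section TruncPathCoalgebra

variable (k : Type*) [Field k] (V : Type*) [Quiver V] (n : ℕ)

/-- The `n`-truncated path coalgebra: the subcoalgebra of the path coalgebra spanned by the paths
of length at most `n`. As a vector space it has these paths as a basis. -/
def TruncPathCoalgebra : Type _ := TruncPath V n →₀ k

noncomputable instance instAddCommGroup_truncPathCoalgebra :
    AddCommGroup (TruncPathCoalgebra k V n) :=
  inferInstanceAs (AddCommGroup (TruncPath V n →₀ k))

noncomputable instance instModule_truncPathCoalgebra :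
    Module k (TruncPathCoalgebra k V n) :=
  inferInstanceAs (Module k (TruncPath V n →₀ k))

namespace TruncPathCoalgebra

/-- The paths of length at most `n`, as a basis. -/
noncomputable def basis : Module.Basis (TruncPath V n) k (TruncPathCoalgebra k V n) :=
  .ofRepr (LinearEquiv.refl k (TruncPath V n →₀ k))

variable {V}

/-- A path of length at most `n`, as an element of the truncated path coalgebra. By convention a
longer path is sent to `0`; no such path occurs in the comultiplication below. -/
noncomputable def ofPath {a b : V} (p : Quiver.Path a b) : TruncPathCoalgebra k V n :=
  if h : p.length ≤ n then basis k V n ⟨a, b, p, h⟩ else 0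

variable (V)

/-- The comultiplication: `Δ(p)` is the sum of the `q ⊗ r` over all splittings `p = q r`. -/
noncomputable def comulMap : TruncPathCoalgebra k V n →ₗ[k]
    TruncPathCoalgebra k V n ⊗[k] TruncPathCoalgebra k V n :=
  (basis k V n).constr k fun p =>
    ((pathSplits p.path).map fun s => ofPath k n s.2.1 ⊗ₜ[k] ofPath k n s.2.2).sum

/-- The counit: `1` on trivial paths, `0` on nontrivial paths. -/
noncomputable def counitMap : TruncPathCoalgebra k V n →ₗ[k] k :=
  (basis k V n).constr k fun p => if p.path.length = 0 then 1 else 0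

theorem comulMap_ofPath {a b : V} (p : Quiver.Path a b) (h : p.length ≤ n) :
    comulMap k V n (ofPath k n p) =
      ((pathSplits p).map fun s => ofPath k n s.2.1 ⊗ₜ[k] ofPath k n s.2.2).sum := by
  rw [ofPath, dif_pos h, comulMap, Module.Basis.constr_basis]

theorem counitMap_ofPath {a b : V} (p : Quiver.Path a b) (h : p.length ≤ n) :
    counitMap k V n (ofPath k n p) = if p.length = 0 then 1 else 0 := by
  rw [ofPath, dif_pos h, counitMap, Module.Basis.constr_basis]

theorem basis_eq_ofPath (p : TruncPath V n) : basis k V n p = ofPath k n p.path := by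
  rw [ofPath, dif_pos p.length_le]

noncomputable instance instCoalgebra : Coalgebra k (TruncPathCoalgebra k V n) where
  comul := comulMap k V n
  counit := counitMap k V n
  coassoc := by
    apply (basis k V n).ext
    rintro ⟨a, b, p, hp⟩
    rw [basis_eq_ofPath]
    simp only [LinearMap.comp_apply, comulMap_ofPath k V n p hp, map_list_sum, List.map_map,
      Function.comp_def, LinearMap.rTensor_tmul, LinearMap.lTensor_tmul, LinearEquiv.coe_coe]
    refine Eq.trans ?_ ((sum_pathSplits_assoc p (fun c d q r s =>
      ofPath k n q ⊗ₜ[k] (ofPath k n r ⊗ₜ[k] ofPath k n s))).trans ?_)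
    · refine congrArg List.sum (List.map_congr_left fun s hs => ?_)
      have hl := length_add_of_mem_pathSplits p s hs
      rw [comulMap_ofPath k V n _ (by omega)]
      change TensorProduct.assoc k _ _ _ ((TensorProduct.mk k _ _).flip _ _) = _
      simp only [map_list_sum, List.map_map, Function.comp_def, LinearMap.flip_apply,
        TensorProduct.mk_apply, TensorProduct.assoc_tmul]
    · refine congrArg List.sum (List.map_congr_left fun s hs => ?_)
      have hl := length_add_of_mem_pathSplits p s hs
      rw [comulMap_ofPath k V n s.2.2 (by omega)]
      change _ = TensorProduct.mk k _ _ _ _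
      simp only [map_list_sum, List.map_map, Function.comp_def, TensorProduct.mk_apply]
  rTensor_counit_comp_comul := by
    apply (basis k V n).ext
    rintro ⟨a, b, p, hp⟩
    rw [basis_eq_ofPath]
    simp only [LinearMap.comp_apply, comulMap_ofPath k V n p hp, map_list_sum, List.map_map,
      Function.comp_def, LinearMap.rTensor_tmul, TensorProduct.mk_apply]
    rw [sum_pathSplits_left p
      (fun c q r => counitMap k V n (ofPath k n q) ⊗ₜ[k] ofPath k n r)]
    · rw [counitMap_ofPath k V n _ (by simp)]
      simp
    · intro c q r hq
      by_cases h : q.length ≤ n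
      · rw [counitMap_ofPath k V n _ h, if_neg hq, TensorProduct.zero_tmul]
      · have hq' : ofPath k n q = 0 := dif_neg h
        rw [hq', map_zero, TensorProduct.zero_tmul]
  lTensor_counit_comp_comul := by
    apply (basis k V n).ext
    rintro ⟨a, b, p, hp⟩
    rw [basis_eq_ofPath]
    simp only [LinearMap.comp_apply, comulMap_ofPath k V n p hp, map_list_sum, List.map_map,
      Function.comp_def, LinearMap.lTensor_tmul, TensorProduct.mk_apply, LinearMap.flip_apply]
    rw [sum_pathSplits_right p
      (fun c q r => ofPath k n q ⊗ₜ[k] counitMap k V n (ofPath k n r))]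
    · rw [counitMap_ofPath k V n _ (by simp)]
      simp
    · intro c q r hq
      by_cases h : r.length ≤ n
      · rw [counitMap_ofPath k V n _ h, if_neg hq, TensorProduct.tmul_zero]
      · have hr : ofPath k n r = 0 := dif_neg h
        rw [hr, map_zero, TensorProduct.tmul_zero]

end TruncPathCoalgebra

end TruncPathCoalgebra

/-- `Aut(kQ^c_{≤ n})`. -/
noncomputable abbrev truncAut (k : Type*) [Field k] (V : Type*) [Quiver V] (n : ℕ) : Type _ :=
  TruncPathCoalgebra k V n ≃ₗc[k] TruncPathCoalgebra k V n

/-- `Aut₀(kQ^c_{≤ n})`. -/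
noncomputable abbrev truncAutZero (k : Type*) [Field k] (V : Type*) [Quiver V] (n : ℕ) :
    Subgroup (truncAut k V n) :=
  coalgAutZero k (TruncPathCoalgebra k V n)

/-! The coefficient forms of the paths multiply, under the convolution dual to Δ, as paths do in the
path algebra (`tensorForm_coeff_comul`). Hence the vertices are the only group-like elements and
span the coradical, an automorphism permutes them, and it never raises the length of a path
(`coeff_map_of_length_lt`). This gives two surjections. The first is `toQuiverAut` from Aut to
Aut(Q): invertible arrow matrices are square, so arrow counts are preserved; its kernel is Aut₀. The
second is `toArrowUnits` from Aut₀ to the product of the groups GL(s ⟶ t), recording the action on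
arrows modulo trivial paths. An element of its kernel acts trivially on the graded pieces of the
length filtration, so this kernel is unipotent, hence solvable. Surjectivity comes from relabelling
paths and from linear substitution of arrows. Thus Aut₀ is solvable iff the product of the GL's is,
and Aut iff moreover Aut(Q) is. Neither criterion involves n. In the Schurian case the GL's have
size at most 1 and commute; a pair of parallel arrows produces a GL containing SL₂(k), which is
perfect when k has more than three elements. -/

open scoped commutatorElement

/-! ### Unipotent group actions are solvable. -/

section UnipotentGroups

variable {k W G : Type*} [Ring k] [AddCommGroup W] [Module k W] [Group G]

/-- The elements of `G` which move every step `F m` of a filtration into `F (m - r)`. -/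
def filtrationSubgroup (ρ : G →* Module.End k W) (F : ℕ → Submodule k W) (hF : Monotone F)
    (r : ℕ) : Subgroup G where
  -- The condition on `g⁻¹` is imposed separately, since the steps `F m` need not be
  -- finite-dimensional. The subtraction `m - r` truncates at `F 0`.
  carrier := {g | ∀ m, ∀ x ∈ F m, ρ g x - x ∈ F (m - r) ∧ ρ g⁻¹ x - x ∈ F (m - r)}
  one_mem' := by intro m x _; simp
  mul_mem' := by
    intro g h hg hh m x hx
    have stable : ∀ u : G, ρ u x - x ∈ F (m - r) → ρ u x ∈ F m := fun u hu => by
      simpa using add_mem (hF (Nat.sub_le m r) hu) hx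
    constructor
    · have h1 := (hg m _ (stable h (hh m x hx).1)).1
      simpa using add_mem h1 (hh m x hx).1
    · have h1 := (hh m _ (stable g⁻¹ (hg m x hx).2)).2
      simpa using add_mem h1 (hg m x hx).2
  inv_mem' := by
    intro g hg m x hx
    simpa using (hg m x hx).symm

/-- With x = hg·y one has [g,h]x - x = (gh - hg)y = ((g-1)(h-1) - (h-1)(g-1))y, and each product
descends r + s steps. The inverse is covered by [g,h]⁻¹ = [h,g]. -/
theorem commutator_mem_filtrationSubgroup (ρ : G →* Module.End k W) (F : ℕ → Submodule k W)
    (hF : Monotone F) (r s : ℕ) {g h : G} (hg : g ∈ filtrationSubgroup ρ F hF r)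
    (hh : h ∈ filtrationSubgroup ρ F hF s) :
    ⁅g, h⁆ ∈ filtrationSubgroup ρ F hF (r + s) := by
  have key : ∀ r s : ℕ, ∀ g ∈ filtrationSubgroup ρ F hF r, ∀ h ∈ filtrationSubgroup ρ F hF s,
      ∀ m, ∀ x ∈ F m, ρ ⁅g, h⁆ x - x ∈ F (m - (r + s)) := by
    intro r s g hg h hh m x hx
    have stable : ∀ (r : ℕ) (u : G), u ∈ filtrationSubgroup ρ F hF r → ∀ x ∈ F m,
        ρ u⁻¹ x ∈ F m := fun r u hu x hx => by
      simpa using add_mem (hF (Nat.sub_le m r) (hu m x hx).2) hx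
    obtain ⟨y, hy, hxy⟩ : ∃ y ∈ F m, x = ρ (h * g) y := by
      refine ⟨ρ g⁻¹ (ρ h⁻¹ x), stable r g hg _ (stable s h hh x hx), ?_⟩
      rw [← Module.End.mul_apply, ← Module.End.mul_apply, ← map_mul, ← map_mul]
      simp
    have e : ρ ⁅g, h⁆ x - x = (ρ g (ρ h y - y) - (ρ h y - y)) - (ρ h (ρ g y - y) - (ρ g y - y)) := by
      have : ρ ⁅g, h⁆ x = ρ g (ρ h y) := by
        rw [hxy, ← Module.End.mul_apply, ← Module.End.mul_apply, ← map_mul, ← map_mul]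
        simp [commutatorElement_def, mul_assoc]
      rw [this, hxy, map_mul, Module.End.mul_apply, map_sub, map_sub]
      abel
    rw [e]
    refine sub_mem ?_ ?_
    · have := (hg _ _ (hh m y hy).1).1
      rwa [Nat.sub_sub, add_comm s r] at this
    · have := (hh _ _ (hg m y hy).1).1
      rwa [Nat.sub_sub] at this
  intro m x hx
  refine ⟨key r s g hg h hh m x hx, ?_⟩
  rw [commutatorElement_inv, add_comm]
  exact key s r h hh g hg m x hx

/-- A group which acts faithfully and unipotently with respect to a finite filtration is
solvable. -/
theorem isSolvable_of_filtration (ρ : G →* Module.End k W) (hρ : Function.Injective ρ)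
    (F : ℕ → Submodule k W) (hF : Monotone F) (h0 : F 0 = ⊥) (N : ℕ) (hN : F N = ⊤)
    (h : ∀ g m, ∀ x ∈ F m, ρ g x - x ∈ F (m - 1)) : Group.IsSolvable G := by
  have key : ∀ r, derivedSeries G r ≤ filtrationSubgroup ρ F hF (r + 1) := by
    intro r
    induction r with
    | zero => exact fun g _ m x hx => ⟨h g m x hx, h g⁻¹ m x hx⟩
    | succ r ih =>
      rw [derivedSeries_succ, Subgroup.commutator_le]
      intro g hg u hu m x hx
      have := commutator_mem_filtrationSubgroup ρ F hF _ _ (ih hg) (ih hu) m x hx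
      -- The commutator gains 2r + 2 steps; one more than r + 1 is enough.
      have hle : m - (r + 1 + (r + 1)) ≤ m - (r + 1 + 1) := by omega
      exact ⟨hF hle this.1, hF hle this.2⟩
  refine ⟨⟨N, ?_⟩⟩
  rw [eq_bot_iff]
  intro g hg
  rw [Subgroup.mem_bot]
  apply hρ
  ext x
  have := (key N hg N x (hN ▸ Submodule.mem_top)).1
  rw [Nat.sub_eq_zero_of_le (by omega), h0, Submodule.mem_bot, sub_eq_zero] at this
  simpa using this

end UnipotentGroups

/-! ### Non-solvability of general linear groups of size at least two. -/

section GeneralLinear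

variable (k : Type*) [Field k]

/-- The size of the field really matters here: SL₂ over the fields with two or three elements is
solvable. -/
theorem exists_ne_zero_sq_ne_one (hk : 3 < ENat.card k) : ∃ a : k, a ≠ 0 ∧ a ^ 2 ≠ 1 := by
  by_contra! h
  have hsub : (Set.univ : Set k) ⊆ {0, 1, -1} := by
    intro a _
    by_cases ha : a = 0
    · simp [ha]
    · simpa [ha] using sq_eq_one_iff.1 (h a ha)
  have h1 : ENat.card k = (Set.univ : Set k).encard := by simp
  have h2 : (({0, 1, -1} : Set k)).encard ≤ 3 := by
    refine (Set.encard_insert_le _ _).trans ?_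
    refine (add_le_add_left (Set.encard_insert_le _ _) 1).trans ?_
    simp; norm_num
  rw [h1] at hk
  exact absurd (hk.trans_le ((Set.encard_le_encard hsub).trans h2)) (lt_irrefl _)

/-- An element a ≠ 0 with a² ≠ 1 makes SL₂ perfect, whereas a nontrivial solvable group is larger
than its commutator subgroup. -/
theorem not_isSolvable_specialLinearGroup_two (hk : 3 < ENat.card k) :
    ¬ Group.IsSolvable (Matrix.SpecialLinearGroup (Fin 2) k) := by
  intro hs
  obtain ⟨a, ha, hasq⟩ := exists_ne_zero_sq_ne_one k hk
  have : Nontrivial (Matrix.SpecialLinearGroup (Fin 2) k) := by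
    refine ⟨1, Matrix.SpecialLinearGroup.transvection zero_ne_one (1 : k), fun h => ?_⟩
    have := congrArg (fun M => M.1 0 1) h
    simp [Matrix.SpecialLinearGroup.transvection_coe] at this
  have hlt := Group.IsSolvable.commutator_lt_top_of_nontrivial (Matrix.SpecialLinearGroup (Fin 2) k)
  exact hlt.ne (Matrix.SL2.commutator_eq_top ha hasq)

/-- Extend a `2 × 2` matrix by an identity block. -/
def Matrix.extendTwo {ι κ : Type*} [Fintype ι] [DecidableEq ι] [Fintype κ] [DecidableEq κ]
    (e : Fin 2 ⊕ κ ≃ ι) : Matrix (Fin 2) (Fin 2) k →* Matrix ι ι k where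
  toFun M := Matrix.reindexAlgEquiv k k e (Matrix.fromBlocks M 0 0 1)
  map_one' := by rw [Matrix.fromBlocks_one, map_one]
  map_mul' M N := by rw [← map_mul, Matrix.fromBlocks_multiply]; simp

theorem Matrix.extendTwo_injective {ι κ : Type*} [Fintype ι] [DecidableEq ι] [Fintype κ]
    [DecidableEq κ] (e : Fin 2 ⊕ κ ≃ ι) : Function.Injective (Matrix.extendTwo k e) := by
  intro M N h
  exact (Matrix.fromBlocks_inj.1 ((Matrix.reindexAlgEquiv k k e).injective h)).1

theorem not_isSolvable_units_matrix (hk : 3 < ENat.card k) {ι : Type*} [Fintype ι] [DecidableEq ι]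
    [Nontrivial ι] : ¬ Group.IsSolvable (Matrix ι ι k)ˣ := by
  intro hs
  obtain ⟨a, b, hab⟩ := exists_pair_ne ι
  have hinj : Function.Injective (![a, b] : Fin 2 → ι) := by
    intro i j h
    fin_cases i <;> fin_cases j <;> simp_all
  classical
  let e : Fin 2 ⊕ ((Set.range (![a, b] : Fin 2 → ι))ᶜ : Set ι) ≃ ι :=
    ((Equiv.ofInjective _ hinj).sumCongr (Equiv.refl _)).trans (Equiv.Set.sumCompl _)
  let φ : Matrix.SpecialLinearGroup (Fin 2) k →* (Matrix ι ι k)ˣ :=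
    MonoidHom.toHomUnits ((Matrix.extendTwo k e).comp
      ({ toFun := fun M => M.1, map_one' := rfl, map_mul' := fun _ _ => rfl } :
        Matrix.SpecialLinearGroup (Fin 2) k →* Matrix (Fin 2) (Fin 2) k))
  have hφ : Function.Injective φ := by
    intro M N h
    exact Subtype.ext (Matrix.extendTwo_injective k e (congrArg Units.val h))
  exact not_isSolvable_specialLinearGroup_two k hk (Group.isSolvable_of_isSolvable_injective hφ)

end GeneralLinear

namespace TruncPathCoalgebra

/-! ### Coefficient forms and their convolution product. -/

section Coefficients

variable (k : Type*) [Field k] {V : Type*} [Quiver V]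

open scoped Classical in
/-- The Kronecker delta on the set of all paths. -/
noncomputable def pathDelta {a b c d : V} (q : Quiver.Path a b) (p : Quiver.Path c d) : k :=
  -- Comparing in the sigma type allows paths with different endpoints.
  if (⟨a, b, q⟩ : Σ a b : V, Quiver.Path a b) = ⟨c, d, p⟩ then 1 else 0

theorem pathDelta_self {a b : V} (q : Quiver.Path a b) : pathDelta k q q = 1 := if_pos rfl

theorem pathDelta_parallel {a b : V} (q p : Quiver.Path a b) [Decidable (q = p)] :
    pathDelta k q p = if q = p then 1 else 0 := by
  unfold pathDelta
  by_cases h : q = p <;> simp [h]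

theorem pathDelta_of_length_ne {a b c d : V} {q : Quiver.Path a b} {p : Quiver.Path c d}
    (h : q.length ≠ p.length) : pathDelta k q p = 0 := by
  refine if_neg fun e => h ?_
  cases e
  rfl

theorem pathDelta_of_src_ne {a b c d : V} {q : Quiver.Path a b} {p : Quiver.Path c d}
    (h : a ≠ c) : pathDelta k q p = 0 := by
  refine if_neg fun e => h ?_
  cases e
  rfl

theorem pathDelta_of_tgt_ne {a b c d : V} {q : Quiver.Path a b} {p : Quiver.Path c d}
    (h : b ≠ d) : pathDelta k q p = 0 := by
  refine if_neg fun e => h ?_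
  cases e
  rfl

theorem pathDelta_cons_cons {a b c a' b' c' : V} (q : Quiver.Path a b) (e : b ⟶ c)
    (p : Quiver.Path a' b') (f : b' ⟶ c') :
    pathDelta k (q.cons e) (p.cons f) = pathDelta k q p * pathDelta k e.toPath f.toPath := by
  by_cases h : (⟨a, c, q.cons e⟩ : Σ a b : V, Quiver.Path a b) = ⟨a', c', p.cons f⟩
  · cases h
    simp [pathDelta_self]
  · rw [show pathDelta k (q.cons e) (p.cons f) = 0 from if_neg h]
    by_contra hne
    have hq : (⟨a, b, q⟩ : Σ a b : V, Quiver.Path a b) = ⟨a', b', p⟩ := by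
      by_contra h'
      exact hne (by rw [show pathDelta k q p = 0 from if_neg h', zero_mul])
    have he : (⟨b, c, e.toPath⟩ : Σ a b : V, Quiver.Path a b) = ⟨b', c', f.toPath⟩ := by
      by_contra h'
      exact hne (by rw [show pathDelta k e.toPath f.toPath = 0 from if_neg h', mul_zero])
    cases hq
    cases he
    exact h rfl

/-- A path has at most one splitting into the given parts q and r, and has one exactly when it
equals their concatenation. -/
theorem sum_pathSplits_pathDelta {a b c x y : V} (q : Quiver.Path a b) (r : Quiver.Path b c)
    (p : Quiver.Path x y) :
    ((pathSplits p).map fun s => pathDelta k q s.2.1 * pathDelta k r s.2.2).sum =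
      pathDelta k (q.comp r) p := by
  induction r generalizing y with
  | nil =>
    rw [sum_pathSplits_right p (fun c u v => pathDelta k q u * pathDelta k .nil v)]
    · by_cases h : b = y
      · subst h
        simp [pathDelta_self]
      · rw [pathDelta_of_tgt_ne k h, pathDelta_of_tgt_ne k (q := q.comp .nil) h, zero_mul]
    · intro c u v hv
      rw [pathDelta_of_length_ne k (p := v) (by simpa using hv.symm), mul_zero]
  | cons r e ih =>
    cases p with
    | nil =>
      simp only [pathSplits, List.map_cons, List.map_nil, List.sum_cons, List.sum_nil, add_zero]
      rw [pathDelta_of_length_ne k (q := r.cons e) (by simp), mul_zero,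
        pathDelta_of_length_ne k (by simp)]
    | cons p f =>
      simp only [pathSplits, List.map_append, List.map_map, List.map_cons, List.map_nil,
        List.sum_append, List.sum_cons, List.sum_nil, add_zero, Function.comp_def]
      rw [pathDelta_of_length_ne k (q := r.cons e) (p := Quiver.Path.nil) (by simp), mul_zero,
        add_zero, Quiver.Path.comp_cons, pathDelta_cons_cons, ← ih p, ← List.sum_map_mul_right]
      simp only [pathDelta_cons_cons, mul_assoc]

theorem sum_pathSplits_pathDelta_of_ne {a b b' c x y : V} (q : Quiver.Path a b)
    (r : Quiver.Path b' c) (hb : b ≠ b') (p : Quiver.Path x y) :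
    ((pathSplits p).map fun s => pathDelta k q s.2.1 * pathDelta k r s.2.2).sum = 0 := by
  refine List.sum_eq_zero fun z hz => ?_
  obtain ⟨⟨v, s, t⟩, -, rfl⟩ := List.mem_map.1 hz
  by_cases h : b = v
  · rw [pathDelta_of_src_ne k (q := r) (fun h' => hb (h.trans h'.symm)), mul_zero]
  · rw [pathDelta_of_tgt_ne k h, zero_mul]

variable (n : ℕ)

/-- The coefficient of a path, as a linear form on the truncated path coalgebra. -/
noncomputable def coeff {a b : V} (q : Quiver.Path a b) : TruncPathCoalgebra k V n →ₗ[k] k :=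
  (basis k V n).constr k fun p => pathDelta k q p.path

theorem coeff_ofPath {a b c d : V} (q : Quiver.Path a b) (p : Quiver.Path c d)
    (h : p.length ≤ n) : coeff k n q (ofPath k n p) = pathDelta k q p := by
  rw [ofPath, dif_pos h, coeff, Module.Basis.constr_basis]

theorem coeff_eq_coord (p : TruncPath V n) : coeff k n p.path = (basis k V n).coord p := by
  classical
  refine (basis k V n).ext fun q => ?_
  rw [coeff, Module.Basis.constr_basis, Module.Basis.coord_apply, Module.Basis.repr_self,
    Finsupp.single_apply, pathDelta]
  congr 1
  obtain ⟨a, b, p, hp⟩ := p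
  obtain ⟨c, d, q, hq⟩ := q
  simp only [eq_iff_iff]
  constructor
  · intro e
    cases e
    rfl
  · intro e
    cases e
    rfl

theorem ext_coeff {x y : TruncPathCoalgebra k V n}
    (h : ∀ (a b : V) (q : Quiver.Path a b), q.length ≤ n → coeff k n q x = coeff k n q y) :
    x = y := by
  refine (basis k V n).ext_elem fun p => ?_
  have := h _ _ p.path p.length_le
  rwa [coeff_eq_coord] at this

theorem linearMap_ext_ofPath {M : Type*} [AddCommGroup M] [Module k M]
    {f g : TruncPathCoalgebra k V n →ₗ[k] M}
    (h : ∀ (a b : V) (p : Quiver.Path a b), p.length ≤ n → f (ofPath k n p) = g (ofPath k n p)) :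
    f = g := by
  refine (basis k V n).ext fun p => ?_
  rw [basis_eq_ofPath]
  exact h _ _ _ p.length_le

theorem comul_ofPath {a b : V} (p : Quiver.Path a b) (h : p.length ≤ n) :
    Coalgebra.comul (R := k) (ofPath k n p) =
      ((pathSplits p).map fun s => ofPath k n s.2.1 ⊗ₜ[k] ofPath k n s.2.2).sum :=
  comulMap_ofPath k V n p h

theorem counit_ofPath {a b : V} (p : Quiver.Path a b) (h : p.length ≤ n) :
    Coalgebra.counit (R := k) (ofPath k n p) = if p.length = 0 then (1 : k) else 0 :=
  counitMap_ofPath k V n p h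

/-- The product of two linear forms, as a linear form on the tensor product. -/
noncomputable def tensorForm {C : Type*} [AddCommGroup C] [Module k C] (φ ψ : C →ₗ[k] k) :
    C ⊗[k] C →ₗ[k] k :=
  TensorProduct.lift ((LinearMap.mul k k).compl₁₂ φ ψ)

@[simp]
theorem tensorForm_tmul {C : Type*} [AddCommGroup C] [Module k C] (φ ψ : C →ₗ[k] k) (x y : C) :
    tensorForm k φ ψ (x ⊗ₜ y) = φ x * ψ y := rfl

/-- The product of the path algebra, seen on the dual of the coalgebra. All later computations with
automorphisms rest on it. -/
theorem tensorForm_coeff_comul {a b c : V} (q : Quiver.Path a b) (r : Quiver.Path b c)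
    (x : TruncPathCoalgebra k V n) :
    tensorForm k (coeff k n q) (coeff k n r) (Coalgebra.comul (R := k) x) =
      coeff k n (q.comp r) x := by
  rw [← LinearMap.comp_apply]
  congr 1
  refine linearMap_ext_ofPath k n fun x y p hp => ?_
  rw [LinearMap.comp_apply, comul_ofPath k n p hp, coeff_ofPath k n _ p hp,
    ← sum_pathSplits_pathDelta, map_list_sum, List.map_map]
  refine congrArg List.sum (List.map_congr_left fun s hs => ?_)
  have := length_add_of_mem_pathSplits p s hs
  rw [Function.comp_apply, tensorForm_tmul, coeff_ofPath k n _ _ (by omega),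
    coeff_ofPath k n _ _ (by omega)]

theorem tensorForm_coeff_comul_of_ne {a b b' c : V} (q : Quiver.Path a b) (r : Quiver.Path b' c)
    (hb : b ≠ b') (x : TruncPathCoalgebra k V n) :
    tensorForm k (coeff k n q) (coeff k n r) (Coalgebra.comul (R := k) x) = 0 := by
  suffices h : tensorForm k (coeff k n q) (coeff k n r) ∘ₗ Coalgebra.comul (R := k) = 0 from
    LinearMap.congr_fun h x
  refine linearMap_ext_ofPath k n fun x y p hp => ?_
  rw [LinearMap.comp_apply, comul_ofPath k n p hp, LinearMap.zero_apply,
    ← sum_pathSplits_pathDelta_of_ne k q r hb p, map_list_sum, List.map_map]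
  refine congrArg List.sum (List.map_congr_left fun s hs => ?_)
  have := length_add_of_mem_pathSplits p s hs
  rw [Function.comp_apply, tensorForm_tmul, coeff_ofPath k n _ _ (by omega),
    coeff_ofPath k n _ _ (by omega)]

end Coefficients

/-! ### The filtration by path length. -/

section Filtration

variable (k : Type*) [Field k] (V : Type*) [Quiver V] (n : ℕ)

/-- The span of the paths of length less than `m`, as the common zeros of the coefficients of the
other paths. -/
noncomputable def pathFiltration (m : ℕ) : Submodule k (TruncPathCoalgebra k V n) where
  carrier := {x | ∀ (a b : V) (q : Quiver.Path a b), m ≤ q.length → coeff k n q x = 0}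
  zero_mem' := by simp
  add_mem' := by
    intro x y hx hy a b q hq
    rw [map_add, hx a b q hq, hy a b q hq, add_zero]
  smul_mem' := by
    intro c x hx a b q hq
    rw [map_smul, hx a b q hq, smul_zero]

variable {V}

theorem ofPath_mem_pathFiltration {a b : V} (p : Quiver.Path a b) {m : ℕ} (h : p.length < m) :
    ofPath k n p ∈ pathFiltration k V n m := by
  intro c d q hq
  by_cases hp : p.length ≤ n
  · rw [coeff_ofPath k n q p hp, pathDelta_of_length_ne k (by omega)]
  · rw [ofPath, dif_neg hp, map_zero]

variable (V)

theorem pathFiltration_eq_span (m : ℕ) :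
    pathFiltration k V n m =
      Submodule.span k ((basis k V n) '' {p : TruncPath V n | p.path.length < m}) := by
  apply le_antisymm
  · intro x hx
    rw [Module.Basis.mem_span_image]
    intro p hp
    by_contra hlt
    have := hx _ _ p.path (not_lt.1 hlt)
    rw [coeff_eq_coord] at this
    exact (Finsupp.mem_support_iff.1 hp) this
  · rw [Submodule.span_le]
    rintro _ ⟨p, hp, rfl⟩
    rw [basis_eq_ofPath]
    exact ofPath_mem_pathFiltration k n _ hp

theorem pathFiltration_mono : Monotone (pathFiltration k V n) :=
  fun _ _ h _ hx a b q hq => hx a b q (h.trans hq)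

theorem pathFiltration_zero : pathFiltration k V n 0 = ⊥ := by
  rw [eq_bot_iff]
  intro x hx
  rw [Submodule.mem_bot]
  exact ext_coeff k n fun a b q _ => by rw [hx a b q (Nat.zero_le _), map_zero]

theorem pathFiltration_succ_eq_top : pathFiltration k V n (n + 1) = ⊤ := by
  rw [pathFiltration_eq_span, eq_top_iff, ← (basis k V n).span_eq]
  refine Submodule.span_mono ?_
  rintro _ ⟨p, rfl⟩
  exact ⟨p, Nat.lt_succ_of_le p.length_le, rfl⟩

variable {k V n}

theorem map_mem_of_ofPath_mem {M : Type*} [AddCommGroup M] [Module k M]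
    (f : TruncPathCoalgebra k V n →ₗ[k] M) (S : Submodule k M) (m : ℕ)
    (h : ∀ (a b : V) (p : Quiver.Path a b), p.length ≤ n → p.length < m → f (ofPath k n p) ∈ S)
    {x : TruncPathCoalgebra k V n} (hx : x ∈ pathFiltration k V n m) : f x ∈ S := by
  rw [pathFiltration_eq_span] at hx
  have : Submodule.span k ((basis k V n) '' {p : TruncPath V n | p.path.length < m}) ≤
      S.comap f := by
    rw [Submodule.span_le]
    rintro _ ⟨p, hp, rfl⟩
    rw [basis_eq_ofPath]
    exact h _ _ p.path p.length_le hp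
  exact this hx

end Filtration

/-! ### Group-like elements and the coradical. -/

section Coradical

variable (k : Type*) [Field k]

/-- Contracting the left factor of an element of D ⊗ D leaves an element of D; this is how elements
of a subcoalgebra are produced. -/
theorem _root_.IsSubcoalgebra.lid_rTensor_comul_mem {C : Type*} [AddCommGroup C] [Module k C]
    [Coalgebra k C] {D : Submodule k C} (hD : IsSubcoalgebra k D) (φ : C →ₗ[k] k) {x : C}
    (hx : x ∈ D) : TensorProduct.lid k C (φ.rTensor C (Coalgebra.comul (R := k) x)) ∈ D := by
  obtain ⟨y, hy⟩ := hD x hx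
  rw [← hy]
  clear hy
  induction y using TensorProduct.induction_on with
  | zero => simp
  | tmul u v => simpa using D.smul_mem _ v.2
  | add u v hu hv => simpa using add_mem hu hv

variable {V : Type*} [Quiver V] (n : ℕ)

/-- A vertex, as an element of the truncated path coalgebra. -/
noncomputable abbrev vertex (i : V) : TruncPathCoalgebra k V n :=
  ofPath k n (Quiver.Path.nil : Quiver.Path i i)

theorem coeff_vertex {a b : V} (q : Quiver.Path a b) (i : V) :
    coeff k n q (vertex k n i) = pathDelta k q (Quiver.Path.nil : Quiver.Path i i) :=
  coeff_ofPath k n q _ (Nat.zero_le _)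

theorem coeff_lid_rTensor (φ ψ : TruncPathCoalgebra k V n →ₗ[k] k)
    (t : TruncPathCoalgebra k V n ⊗[k] TruncPathCoalgebra k V n) :
    ψ (TensorProduct.lid k _ (φ.rTensor _ t)) = tensorForm k φ ψ t := by
  induction t using TensorProduct.induction_on with
  | zero => simp
  | tmul u v => simp
  | add u v hu hv => simp only [map_add, hu, hv]

theorem vertex_injective : Function.Injective (vertex k n : V → TruncPathCoalgebra k V n) := by
  intro i j h
  by_contra hij
  have := congrArg (coeff k n (Quiver.Path.nil : Quiver.Path i i)) h
  rw [coeff_vertex, coeff_vertex, pathDelta_self, pathDelta_of_src_ne k hij] at this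
  exact one_ne_zero this

theorem comul_vertex (i : V) :
    Coalgebra.comul (R := k) (vertex k n i) = vertex k n i ⊗ₜ vertex k n i := by
  rw [vertex, comul_ofPath k n _ (Nat.zero_le _)]
  simp [pathSplits]

theorem counit_vertex (i : V) : Coalgebra.counit (R := k) (vertex k n i) = (1 : k) := by
  rw [vertex, counit_ofPath k n _ (Nat.zero_le _)]
  simp

/-- Contract Δ(x) with the coefficient form of a longest path p in the support of x. The coefficient
of r in the result is that of pr in x, which vanishes by maximality unless r is trivial. What
remains is a nonzero multiple of the vertex at the end of p. -/
theorem exists_vertex_mem {D : Submodule k (TruncPathCoalgebra k V n)} (hD : IsSubcoalgebra k D)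
    (h0 : D ≠ ⊥) : ∃ i : V, vertex k n i ∈ D := by
  obtain ⟨x, hx, hx0⟩ := D.ne_bot_iff.1 h0
  have hne : ((basis k V n).repr x).support.Nonempty := by
    rw [Finsupp.support_nonempty_iff]
    simpa using hx0
  obtain ⟨p, hp, hmax⟩ := Finset.exists_max_image _ (fun p : TruncPath V n => p.path.length) hne
  have hc : coeff k n p.path x ≠ 0 := by
    rw [coeff_eq_coord]
    exact Finsupp.mem_support_iff.1 hp
  have hlong : ∀ (a b : V) (q : Quiver.Path a b), p.path.length < q.length →
      q.length ≤ n → coeff k n q x = 0 := by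
    intro a b q hq hn
    by_contra hne
    have := coeff_eq_coord k n ⟨a, b, q, hn⟩
    rw [this] at hne
    have := hmax _ (Finsupp.mem_support_iff.2 hne)
    simp only at this
    omega
  have hlong' : ∀ (a b : V) (q : Quiver.Path a b), p.path.length < q.length →
      coeff k n q x = 0 := by
    intro a b q hq
    by_cases hn : q.length ≤ n
    · exact hlong a b q hq hn
    · have : x ∈ pathFiltration k V n (n + 1) := by
        rw [pathFiltration_succ_eq_top]
        trivial
      exact this a b q (by omega)
  refine ⟨p.tgt, ?_⟩
  have hz := hD.lid_rTensor_comul_mem k (coeff k n p.path) hx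
  have e : TensorProduct.lid k _ ((coeff k n p.path).rTensor _ (Coalgebra.comul (R := k) x)) =
      coeff k n p.path x • vertex k n p.tgt := by
    refine ext_coeff k n fun a b r _ => ?_
    rw [coeff_lid_rTensor, map_smul, smul_eq_mul, coeff_vertex]
    by_cases h : p.tgt = a
    · subst h
      rw [tensorForm_coeff_comul]
      cases r with
      | nil => rw [pathDelta_self, mul_one, Quiver.Path.comp_nil]
      | cons r e =>
        rw [hlong' _ _ _ (by simp [Quiver.Path.length_comp]),
          pathDelta_of_length_ne k (by simp), mul_zero]
    · rw [tensorForm_coeff_comul_of_ne k n _ _ h, pathDelta_of_src_ne k (Ne.symm h), mul_zero]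
  rw [e] at hz
  exact (D.smul_mem_iff hc).1 hz

theorem _root_.isSubcoalgebra_span_singleton {C : Type*} [AddCommGroup C] [Module k C]
    [Coalgebra k C] {x : C} (hx : Coalgebra.comul (R := k) x = x ⊗ₜ x) :
    IsSubcoalgebra k (Submodule.span k {x}) := by
  intro y hy
  obtain ⟨c, rfl⟩ := Submodule.mem_span_singleton.1 hy
  have hm := Submodule.mem_span_singleton_self (R := k) x
  refine ⟨c • (⟨x, hm⟩ ⊗ₜ ⟨x, hm⟩), ?_⟩
  rw [map_smul, map_smul, hx]
  rfl

/-- The line through a group-like element is a nonzero subcoalgebra, so it contains a vertex; the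
counit fixes the scalar. -/
theorem exists_eq_vertex {x : TruncPathCoalgebra k V n}
    (hx : Coalgebra.comul (R := k) x = x ⊗ₜ x) (hε : Coalgebra.counit (R := k) x = (1 : k)) :
    ∃ i, x = vertex k n i := by
  have h0 : Submodule.span k {x} ≠ ⊥ := by
    rw [Ne, Submodule.span_singleton_eq_bot]
    rintro rfl
    simp at hε
  obtain ⟨i, hi⟩ := exists_vertex_mem k n (isSubcoalgebra_span_singleton k hx) h0
  obtain ⟨c, hc⟩ := Submodule.mem_span_singleton.1 hi
  have := congrArg (Coalgebra.counit (R := k)) hc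
  rw [map_smul, hε, counit_vertex, smul_eq_mul, mul_one] at this
  exact ⟨i, by rw [← hc, this, one_smul]⟩

theorem isSimpleSubcoalgebra_span_vertex (i : V) :
    IsSimpleSubcoalgebra k (Submodule.span k {vertex k n i}) := by
  refine ⟨isSubcoalgebra_span_singleton k (comul_vertex k n i), ?_, fun E hE hle => ?_⟩
  · rw [Ne, Submodule.span_singleton_eq_bot]
    intro h
    have := counit_vertex k n i
    rw [h, map_zero] at this
    exact zero_ne_one this
  · by_cases h0 : E = ⊥
    · exact Or.inl h0
    · obtain ⟨j, hj⟩ := exists_vertex_mem k n hE h0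
      obtain ⟨c, hc⟩ := Submodule.mem_span_singleton.1 (hle hj)
      have := congrArg (Coalgebra.counit (R := k)) hc
      rw [map_smul, counit_vertex, counit_vertex, smul_eq_mul, mul_one] at this
      rw [this, one_smul] at hc
      refine Or.inr (le_antisymm hle ?_)
      rw [Submodule.span_singleton_le_iff_mem, hc]
      exact hj

/-- A simple subcoalgebra contains a vertex, whose line is already a subcoalgebra; by simplicity the
two coincide. -/
theorem coradical_eq_span :
    coradical k (TruncPathCoalgebra k V n) = Submodule.span k (Set.range (vertex k n)) := by
  apply le_antisymm
  · refine sSup_le fun D hD => ?_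
    obtain ⟨i, hi⟩ := exists_vertex_mem k n hD.1 hD.2.1
    have hle : Submodule.span k {vertex k n i} ≤ D := by
      rwa [Submodule.span_singleton_le_iff_mem]
    have hs := isSimpleSubcoalgebra_span_vertex k n i
    rcases hD.2.2 _ hs.1 hle with h | h
    · exact absurd h hs.2.1
    · rw [← h]
      exact Submodule.span_mono (by rintro _ rfl; exact ⟨i, rfl⟩)
  · rw [Submodule.span_le]
    rintro _ ⟨i, rfl⟩
    exact (le_sSup (isSimpleSubcoalgebra_span_vertex k n i) :
      _ ≤ coradical k (TruncPathCoalgebra k V n)) (Submodule.mem_span_singleton_self _)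

theorem mem_coalgAutZero_iff (f : truncAut k V n) :
    f ∈ truncAutZero k V n ↔ ∀ i : V, f (vertex k n i) = vertex k n i := by
  change (∀ x ∈ coradical k _, f x = x) ↔ _
  rw [coradical_eq_span]
  constructor
  · exact fun h i => h _ (Submodule.subset_span ⟨i, rfl⟩)
  · intro h x hx
    induction hx using Submodule.span_induction with
    | mem x hx =>
      obtain ⟨i, rfl⟩ := hx
      exact h i
    | zero => exact map_zero f
    | add x y _ _ hx hy => rw [map_add, hx, hy]
    | smul c x _ hx => rw [map_smul, hx]

end Coradical

end TruncPathCoalgebra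

namespace TruncPathCoalgebra

variable {k : Type*} [Field k] {V : Type*} [Quiver V] {n : ℕ}

/-! ### Triangularity of automorphisms with respect to length. -/

section Automorphisms

theorem truncAut_mul_apply (f g : truncAut k V n) (x : TruncPathCoalgebra k V n) :
    (f * g) x = f (g x) := rfl

theorem truncAut_one_apply (x : TruncPathCoalgebra k V n) : (1 : truncAut k V n) x = x := rfl

theorem exists_map_vertex (f : truncAut k V n) (i : V) :
    ∃ j, f (vertex k n i) = vertex k n j := by
  apply exists_eq_vertex
  · rw [← CoalgHomClass.map_comp_comul_apply, comul_vertex, TensorProduct.map_tmul]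
    rfl
  · rw [CoalgHomClass.counit_comp_apply, counit_vertex]

theorem coeff_comp_map_ofPath (f : truncAut k V n) {a b c x y : V} (q : Quiver.Path a b)
    (r : Quiver.Path b c) (p : Quiver.Path x y) (hp : p.length ≤ n) :
    coeff k n (q.comp r) (f (ofPath k n p)) = ((pathSplits p).map fun s =>
      coeff k n q (f (ofPath k n s.2.1)) * coeff k n r (f (ofPath k n s.2.2))).sum := by
  rw [← tensorForm_coeff_comul, ← CoalgHomClass.map_comp_comul_apply, comul_ofPath k n p hp]
  simp only [map_list_sum, List.map_map, Function.comp_def, TensorProduct.map_tmul,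
    tensorForm_tmul]
  rfl

theorem coeff_map_vertex (f : truncAut k V n) {a b : V} (q : Quiver.Path a b) (hq : 0 < q.length)
    (i : V) : coeff k n q (f (vertex k n i)) = 0 := by
  obtain ⟨j, hj⟩ := exists_map_vertex f i
  rw [hj, coeff_vertex, pathDelta_of_length_ne k (by simpa using hq.ne')]

theorem coeff_map_of_length_eq_zero (f : truncAut k V n) {a b : V} (q : Quiver.Path a b)
    (hq : 0 < q.length) {x y : V} (p : Quiver.Path x y) (hp : p.length = 0) :
    coeff k n q (f (ofPath k n p)) = 0 := by
  cases p with
  | nil => exact coeff_map_vertex f q hq x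
  | cons p e => simp at hp

/-- Induction on q, detaching its last arrow. For a splitting p = st, either t is trivial and its
image is a vertex, which has no arrow component, or s is shorter than p and the induction hypothesis
applies. -/
theorem coeff_map_of_length_lt (f : truncAut k V n) {a b x y : V} (q : Quiver.Path a b)
    (p : Quiver.Path x y) (hp : p.length ≤ n) (h : p.length < q.length) :
    coeff k n q (f (ofPath k n p)) = 0 := by
  induction q generalizing x y with
  | nil => simp at h
  | cons q e ih =>
    rw [← Quiver.Path.comp_toPath_eq_cons, coeff_comp_map_ofPath f q e.toPath p hp]
    refine List.sum_eq_zero fun z hz => ?_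
    obtain ⟨⟨v, s, t⟩, hs, rfl⟩ := List.mem_map.1 hz
    have hl := length_add_of_mem_pathSplits p _ hs
    simp only [Quiver.Path.length_cons] at hl h
    by_cases ht : t.length = 0
    · rw [coeff_map_of_length_eq_zero f e.toPath (by simp) t ht, mul_zero]
    · rw [ih s (by omega) (by omega), zero_mul]

theorem map_mem_pathFiltration (f : truncAut k V n) (m : ℕ) {x : TruncPathCoalgebra k V n}
    (hx : x ∈ pathFiltration k V n m) : f x ∈ pathFiltration k V n m :=
  map_mem_of_ofPath_mem (f : TruncPathCoalgebra k V n →ₗ[k] TruncPathCoalgebra k V n)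
    (pathFiltration k V n m) m (fun _ _ p hp hm _ _ q hq => coeff_map_of_length_lt f q p hp (hm.trans_le hq)) hx

/-- The top-degree part of an automorphism is multiplicative: a trivial right part maps to a vertex,
and a left part shorter than q cannot reach q. Only the splitting into p and d survives. -/
theorem coeff_cons_map_cons (f : truncAut k V n) {a b c x y z : V} (q : Quiver.Path a b)
    (e : b ⟶ c) (p : Quiver.Path x y) (d : y ⟶ z) (hp : p.length + 1 ≤ n)
    (h : p.length = q.length) :
    coeff k n (q.cons e) (f (ofPath k n (p.cons d))) =
      coeff k n q (f (ofPath k n p)) * coeff k n e.toPath (f (ofPath k n d.toPath)) := by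
  rw [← Quiver.Path.comp_toPath_eq_cons, coeff_comp_map_ofPath f q e.toPath _ (by simpa using hp)]
  simp only [pathSplits, List.map_append, List.map_map, List.map_cons, List.map_nil,
    List.sum_append, List.sum_cons, List.sum_nil, add_zero, Function.comp_def]
  rw [coeff_map_vertex f e.toPath (by simp), mul_zero, add_zero]
  cases p with
  | nil => simp [pathSplits, Quiver.Hom.toPath]
  | cons p d' =>
    simp only [pathSplits, List.map_append, List.map_map, List.map_cons, List.map_nil,
      List.sum_append, List.sum_cons, List.sum_nil, add_zero, Function.comp_def]
    refine add_eq_right.2 ?_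
    refine List.sum_eq_zero fun w hw => ?_
    obtain ⟨⟨v, s, t⟩, hs, rfl⟩ := List.mem_map.1 hw
    have hl := length_add_of_mem_pathSplits p _ hs
    simp only [Quiver.Path.length_cons] at hl h hp
    rw [coeff_map_of_length_lt f q s (by omega) (by omega), zero_mul]

/-- Write e as e_a·e or e·e_b and use Δ(d) = e_x ⊗ d + d ⊗ e_y: one term dies because the vertices
differ, the other because a vertex has no arrow component. -/
theorem coeff_arrow_map_arrow (f : truncAut k V n) (hn : 1 ≤ n) {x y a b i j : V} (d : x ⟶ y)
    (e : a ⟶ b) (hi : f (vertex k n x) = vertex k n i) (hj : f (vertex k n y) = vertex k n j)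
    (h : i ≠ a ∨ j ≠ b) : coeff k n e.toPath (f (ofPath k n d.toPath)) = 0 := by
  rcases h with h | h
  · rw [← Quiver.Path.nil_comp e.toPath, coeff_comp_map_ofPath f _ _ d.toPath (by simpa using hn)]
    simp only [Quiver.Hom.toPath, pathSplits, List.map_append, List.map_cons, List.map_nil,
      List.sum_append, List.sum_cons, List.sum_nil, add_zero]
    rw [hi, hj, coeff_vertex, coeff_vertex, pathDelta_of_src_ne k h.symm, zero_mul,
      pathDelta_of_length_ne k (by simp), mul_zero, add_zero]
  · rw [← Quiver.Path.comp_nil e.toPath, coeff_comp_map_ofPath f _ _ d.toPath (by simpa using hn)]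
    simp only [Quiver.Hom.toPath, pathSplits, List.map_append, List.map_cons, List.map_nil,
      List.sum_append, List.sum_cons, List.sum_nil, add_zero]
    rw [hi, hj, coeff_vertex, coeff_vertex, pathDelta_of_src_ne k h.symm, mul_zero,
      pathDelta_of_length_ne k (by simp), zero_mul, add_zero]

end Automorphisms

/-! ### The permutation of the vertices. -/

section VertexAction

theorem vertex_eq_iff {i j : V} : vertex k n i = vertex k n j ↔ i = j :=
  (vertex_injective k n).eq_iff

/-- The action of an automorphism on the vertices. -/
noncomputable def vertexMap (f : truncAut k V n) (i : V) : V := (exists_map_vertex f i).choose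

theorem map_vertex (f : truncAut k V n) (i : V) :
    f (vertex k n i) = vertex k n (vertexMap f i) := (exists_map_vertex f i).choose_spec

theorem vertexMap_eq_iff (f : truncAut k V n) (i j : V) :
    vertexMap f i = j ↔ f (vertex k n i) = vertex k n j := by
  rw [map_vertex, vertex_eq_iff]

theorem vertexMap_mul (f g : truncAut k V n) (i : V) :
    vertexMap (f * g) i = vertexMap f (vertexMap g i) := by
  rw [vertexMap_eq_iff, truncAut_mul_apply, map_vertex, map_vertex]

theorem vertexMap_one (i : V) : vertexMap (1 : truncAut k V n) i = i := by
  rw [vertexMap_eq_iff, truncAut_one_apply]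

variable (k V n) in
/-- The permutation of the vertices defined by an automorphism. -/
noncomputable def vertexPerm : truncAut k V n →* Equiv.Perm V where
  toFun f :=
    { toFun := vertexMap f
      invFun := vertexMap f⁻¹
      left_inv := fun i => by rw [← vertexMap_mul, inv_mul_cancel, vertexMap_one]
      right_inv := fun i => by rw [← vertexMap_mul, mul_inv_cancel, vertexMap_one] }
  map_one' := Equiv.ext vertexMap_one
  map_mul' f g := Equiv.ext (vertexMap_mul f g)

theorem vertexPerm_apply (f : truncAut k V n) (i : V) : vertexPerm k V n f i = vertexMap f i := rfl

theorem ker_vertexPerm : (vertexPerm k V n).ker = truncAutZero k V n := by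
  ext f
  rw [MonoidHom.mem_ker, mem_coalgAutZero_iff, Equiv.ext_iff]
  refine forall_congr' fun i => ?_
  rw [vertexPerm_apply, Equiv.Perm.one_apply, vertexMap_eq_iff]

end VertexAction

/-! ### The action on arrows and its unipotent kernel. -/

section ArrowMatrix

/-- The matrix of the action of an automorphism on the arrows, modulo trivial paths. -/
noncomputable def arrowMatrix (f : truncAut k V n) (s t s' t' : V) :
    Matrix (s' ⟶ t') (s ⟶ t) k :=
  .of fun e d => coeff k n e.toPath (f (ofPath k n d.toPath))

theorem arrowMatrix_apply (f : truncAut k V n) (s t s' t' : V) (e : s' ⟶ t') (d : s ⟶ t) :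
    arrowMatrix f s t s' t' e d = coeff k n e.toPath (f (ofPath k n d.toPath)) := rfl

theorem pathDelta_toPath {s t : V} [DecidableEq (s ⟶ t)] (e d : s ⟶ t) :
    pathDelta k e.toPath d.toPath = if e = d then 1 else 0 := by
  classical
  rw [pathDelta_parallel]
  refine if_congr ⟨fun h => ?_, fun h => h ▸ rfl⟩ rfl rfl
  simpa [Quiver.Hom.toPath] using h

theorem arrowMatrix_one (hn : 1 ≤ n) (s t : V) [DecidableEq (s ⟶ t)] :
    arrowMatrix (1 : truncAut k V n) s t s t = 1 := by
  ext e d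
  rw [arrowMatrix_apply, truncAut_one_apply, coeff_ofPath k n _ _ (by simpa using hn),
    pathDelta_toPath, Matrix.one_apply]

/-- Step 1 of the filtration is the span of the vertices. It is stable under automorphisms and
invisible to arrow coefficients, so this error term does not disturb the multiplicativity of
`arrowMatrix`. -/
theorem arrow_sub_sum_mem (g : truncAut k V n) (hn : 1 ≤ n) {s t s' t' : V} [Fintype (s' ⟶ t')]
    (hs : g (vertex k n s) = vertex k n s') (ht : g (vertex k n t) = vertex k n t')
    (d : s ⟶ t) :
    g (ofPath k n d.toPath) - ∑ c : s' ⟶ t', arrowMatrix g s t s' t' c d • ofPath k n c.toPath ∈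
      pathFiltration k V n 1 := by
  classical
  intro a b q hq
  rw [map_sub, map_sum]
  simp only [map_smul, smul_eq_mul, arrowMatrix_apply]
  rw [Finset.sum_congr rfl fun c _ => by
    rw [coeff_ofPath k n q c.toPath (by simpa using hn)]]
  by_cases h2 : 2 ≤ q.length
  · rw [coeff_map_of_length_lt g q d.toPath (by simpa using hn) (by simpa [Nat.lt_iff_add_one_le] using h2),
      Finset.sum_eq_zero, sub_zero]
    intro c _
    rw [pathDelta_of_length_ne k (by simp; omega), mul_zero]
  · obtain ⟨e, rfl⟩ : ∃ e : a ⟶ b, q = e.toPath := by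
      cases q with
      | nil => simp at hq
      | cons q e =>
        cases q with
        | nil => exact ⟨e, rfl⟩
        | cons q e' => simp at h2
    by_cases hab : s' = a ∧ t' = b
    · obtain ⟨rfl, rfl⟩ := hab
      simp [pathDelta_toPath]
    · have hab' : s' ≠ a ∨ t' ≠ b := by tauto
      rw [coeff_arrow_map_arrow g hn d e hs ht hab', Finset.sum_eq_zero, sub_zero]
      intro c _
      rcases hab' with h | h
      · rw [pathDelta_of_src_ne k h.symm, mul_zero]
      · rw [pathDelta_of_tgt_ne k h.symm, mul_zero]

theorem arrowMatrix_mul (f g : truncAut k V n) (hn : 1 ≤ n) {s t s' t' : V} [Fintype (s' ⟶ t')]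
    (hs : g (vertex k n s) = vertex k n s') (ht : g (vertex k n t) = vertex k n t')
    (s'' t'' : V) :
    arrowMatrix (f * g) s t s'' t'' = arrowMatrix f s' t' s'' t'' * arrowMatrix g s t s' t' := by
  ext e d
  have h := map_mem_pathFiltration f 1 (arrow_sub_sum_mem g hn hs ht d) _ _ e.toPath le_rfl
  rw [map_sub, map_sub, sub_eq_zero, map_sum, map_sum] at h
  rw [arrowMatrix_apply, truncAut_mul_apply, h, Matrix.mul_apply]
  refine Finset.sum_congr rfl fun c _ => ?_
  rw [map_smul, map_smul, smul_eq_mul, mul_comm, arrowMatrix_apply f]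

/-- The arrow matrices of f and f⁻¹ are mutually inverse, and an invertible matrix over a field is
square. -/
theorem vertexPerm_mem_quiverAut [∀ s t : V, Finite (s ⟶ t)] (hn : 1 ≤ n) (f : truncAut k V n) :
    vertexPerm k V n f ∈ quiverAut V := by
  classical
  intro s t
  change Nonempty ((s ⟶ t) ≃ (vertexMap f s ⟶ vertexMap f t))
  have : ∀ s t : V, Fintype (s ⟶ t) := fun s t => Fintype.ofFinite _
  have inv : ∀ i, f⁻¹ (vertex k n (vertexMap f i)) = vertex k n i := fun i => by
    rw [← map_vertex, ← truncAut_mul_apply, inv_mul_cancel, truncAut_one_apply]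
  refine Fintype.card_eq.1 (Matrix.square_of_invertible
    (arrowMatrix f⁻¹ (vertexMap f s) (vertexMap f t) s t)
    (arrowMatrix f s t (vertexMap f s) (vertexMap f t)) ?_ ?_)
  · rw [← arrowMatrix_mul f⁻¹ f hn (map_vertex f s) (map_vertex f t), inv_mul_cancel,
      arrowMatrix_one hn]
  · rw [← arrowMatrix_mul f f⁻¹ hn (inv s) (inv t), mul_inv_cancel, arrowMatrix_one hn]

variable (k V n) in
/-- The homomorphism from the automorphism group to the automorphism group of the quiver. -/
noncomputable def toQuiverAut [∀ s t : V, Finite (s ⟶ t)] (hn : 1 ≤ n) :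
    truncAut k V n →* quiverAut V :=
  (vertexPerm k V n).codRestrict (quiverAut V) (vertexPerm_mem_quiverAut hn)

theorem ker_toQuiverAut [∀ s t : V, Finite (s ⟶ t)] (hn : 1 ≤ n) :
    (toQuiverAut k V n hn).ker = truncAutZero k V n := by
  rw [toQuiverAut, MonoidHom.ker_codRestrict, ker_vertexPerm]

variable [∀ s t : V, Fintype (s ⟶ t)] [∀ s t : V, DecidableEq (s ⟶ t)]

variable (k V) in
/-- The invertible linear transformations of all the spaces spanned by parallel arrows. -/
abbrev ArrowUnits : Type _ := (∀ s t : V, Matrix (s ⟶ t) (s ⟶ t) k)ˣ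

variable (k V n) in
/-- The action of the automorphisms fixing the coradical on the arrows, modulo trivial paths. -/
noncomputable def toArrowUnits (hn : 1 ≤ n) : truncAutZero k V n →* ArrowUnits k V :=
  MonoidHom.toHomUnits
    { toFun := fun f s t => arrowMatrix f.1 s t s t
      map_one' := by
        funext s t
        exact arrowMatrix_one hn s t
      map_mul' := by
        intro f g
        funext s t
        have h := (mem_coalgAutZero_iff k n g.1).1 g.2
        exact arrowMatrix_mul f.1 g.1 hn (h s) (h t) s t }

theorem toArrowUnits_apply (hn : 1 ≤ n) (f : truncAutZero k V n) (s t : V) :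
    (toArrowUnits k V n hn f : ∀ s t : V, Matrix (s ⟶ t) (s ⟶ t) k) s t =
      arrowMatrix f.1 s t s t := rfl

/-- By multiplicativity of the top-degree part, being trivial on vertices and arrows forces
triviality on the whole associated graded space. -/
theorem coeff_map_of_mem_ker (hn : 1 ≤ n) {f : truncAutZero k V n}
    (hf : f ∈ (toArrowUnits k V n hn).ker) {a b x y : V} (q : Quiver.Path a b)
    (p : Quiver.Path x y) (hp : p.length ≤ n) (h : p.length = q.length) :
    coeff k n q (f.1 (ofPath k n p)) = pathDelta k q p := by
  have hv := (mem_coalgAutZero_iff k n f.1).1 f.2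
  induction q generalizing x y with
  | nil =>
    cases p with
    | nil => rw [hv, coeff_vertex]
    | cons p d => simp at h
  | cons q e ih =>
    cases p with
    | nil => simp at h
    | cons p d =>
      rename_i b c z
      simp only [Quiver.Path.length_cons] at h hp
      rw [coeff_cons_map_cons f.1 q e p d hp (by omega), ih p (by omega) (by omega),
        pathDelta_cons_cons]
      congr 1
      by_cases hab : z = b ∧ y = c
      · obtain ⟨rfl, rfl⟩ := hab
        have := congrArg (fun u : ArrowUnits k V => u.1 z y e d) hf
        simp only [toArrowUnits_apply, arrowMatrix_apply, Units.val_one, Pi.one_apply] at this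
        rw [this, pathDelta_toPath, Matrix.one_apply]
      · have hab' : z ≠ b ∨ y ≠ c := by tauto
        rw [coeff_arrow_map_arrow f.1 hn d e (hv z) (hv y) hab']
        rcases hab' with h | h
        · rw [pathDelta_of_src_ne k h.symm]
        · rw [pathDelta_of_tgt_ne k h.symm]

theorem map_sub_mem_of_mem_ker (hn : 1 ≤ n) {f : truncAutZero k V n}
    (hf : f ∈ (toArrowUnits k V n hn).ker) (m : ℕ) {x : TruncPathCoalgebra k V n}
    (hx : x ∈ pathFiltration k V n m) : f.1 x - x ∈ pathFiltration k V n (m - 1) := by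
  let φ : TruncPathCoalgebra k V n →ₗ[k] TruncPathCoalgebra k V n :=
    f.1.toLinearEquiv.toLinearMap - LinearMap.id
  have hφ : ∀ y, φ y = f.1 y - y := fun _ => rfl
  have key := map_mem_of_ofPath_mem φ (pathFiltration k V n (m - 1)) m (by
    intro a b p hp hm c d q hq
    rw [hφ, map_sub, coeff_ofPath k n q p hp]
    rcases (show p.length ≤ q.length by omega).eq_or_lt with h | h
    · rw [coeff_map_of_mem_ker hn hf q p hp h, sub_self]
    · rw [coeff_map_of_length_lt f.1 q p hp h, pathDelta_of_length_ne k h.ne', sub_zero]) hx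
  rwa [hφ] at key

/-- The natural linear representation of the automorphism group. -/
noncomputable def truncAutRep : truncAut k V n →* Module.End k (TruncPathCoalgebra k V n) where
  toFun f := (f : TruncPathCoalgebra k V n →ₗ[k] TruncPathCoalgebra k V n)
  map_one' := rfl
  map_mul' _ _ := rfl

theorem isSolvable_ker_toArrowUnits (hn : 1 ≤ n) :
    Group.IsSolvable (toArrowUnits k V n hn).ker := by
  refine isSolvable_of_filtration
    (truncAutRep.comp ((truncAutZero k V n).subtype.comp (toArrowUnits k V n hn).ker.subtype))
    ?_ (pathFiltration k V n) (pathFiltration_mono k V n) (pathFiltration_zero k V n) (n + 1)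
    (pathFiltration_succ_eq_top k V n) (fun g m x hx => map_sub_mem_of_mem_ker hn g.2 m hx)
  intro f g h
  apply Subtype.ext
  apply Subtype.ext
  ext x
  exact LinearMap.congr_fun h x

end ArrowMatrix

end TruncPathCoalgebra

namespace TruncPathCoalgebra

variable {k : Type*} [Field k] {V : Type*} [Quiver V]

theorem coalgHom_ext_ofPath (n : ℕ) {f g : TruncPathCoalgebra k V n →ₗc[k] TruncPathCoalgebra k V n}
    (h : ∀ (a b : V) (p : Quiver.Path a b), p.length ≤ n → f (ofPath k n p) = g (ofPath k n p)) :
    f = g := by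
  have e : f.toLinearMap = g.toLinearMap := linearMap_ext_ofPath k n h
  ext x
  exact LinearMap.congr_fun e x

/-! ### Linear substitutions of arrows realize every family of invertible matrices. -/

section LinearSubstitution

variable [∀ s t : V, Fintype (s ⟶ t)] {M N : Type*} [AddCommGroup M] [Module k M]
  [AddCommGroup N] [Module k N]

/-- Replace every arrow `e` of a path by the linear combination `∑ c, T c e • c`, and evaluate the
resulting linear combination of paths with a function. -/
noncomputable def pathEval (T : ∀ s t : V, Matrix (s ⟶ t) (s ⟶ t) k) {a : V} :
    ∀ {b : V}, Quiver.Path a b → (Quiver.Path a b → M) →ₗ[k] M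
  | _, .nil => LinearMap.proj .nil
  -- The last arrow is expanded first, which turns a function on paths parallel to `p.cons e` into
  -- one on paths parallel to `p`.
  | _, .cons p e => pathEval T p ∘ₗ
      LinearMap.pi fun q => ∑ c, T _ _ c e • LinearMap.proj (q.cons c)

variable (T S : ∀ s t : V, Matrix (s ⟶ t) (s ⟶ t) k)

theorem pathEval_nil {a : V} (G : Quiver.Path a a → M) : pathEval T .nil G = G .nil := rfl

theorem pathEval_cons {a b c : V} (p : Quiver.Path a b) (e : b ⟶ c) (G : Quiver.Path a c → M) :
    pathEval T (p.cons e) G =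
      pathEval T p fun q => ∑ d : b ⟶ c, T b c d e • G (q.cons d) := by
  rw [pathEval, LinearMap.comp_apply]
  congr 1
  funext q
  simp [LinearMap.sum_apply]

theorem pathEval_toPath {a b : V} (e : a ⟶ b) (G : Quiver.Path a b → M) :
    pathEval T e.toPath G = ∑ d : a ⟶ b, T a b d e • G d.toPath :=
  pathEval_cons T .nil e G

theorem pathEval_congr {a b : V} (p : Quiver.Path a b) {G H : Quiver.Path a b → M}
    (h : ∀ q, q.length = p.length → G q = H q) : pathEval T p G = pathEval T p H := by
  induction p with
  | nil => exact h _ rfl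
  | cons p e ih =>
    rw [pathEval_cons, pathEval_cons]
    refine ih fun q hq => Finset.sum_congr rfl fun d _ => ?_
    rw [h _ (by simp [hq])]

theorem map_pathEval (L : M →ₗ[k] N) {a b : V} (p : Quiver.Path a b) (G : Quiver.Path a b → M) :
    L (pathEval T p G) = pathEval T p fun q => L (G q) := by
  induction p with
  | nil => rfl
  | cons p e ih =>
    rw [pathEval_cons, pathEval_cons, ih]
    simp only [map_sum, map_smul]

theorem pathEval_one [∀ s t : V, DecidableEq (s ⟶ t)] {a b : V} (p : Quiver.Path a b)
    (G : Quiver.Path a b → M) : pathEval (1 : ∀ s t : V, Matrix (s ⟶ t) (s ⟶ t) k) p G = G p := by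
  induction p with
  | nil => rfl
  | cons p e ih =>
    rw [pathEval_cons, ih]
    simp [Matrix.one_apply]

theorem pathEval_pathEval {a b : V} (p : Quiver.Path a b) (G : Quiver.Path a b → M) :
    (pathEval T p fun q => pathEval S q G) = pathEval (S * T) p G := by
  induction p with
  | nil => rfl
  | cons p e ih =>
    rename_i b c
    rw [pathEval_cons, pathEval_cons, ← ih]
    congr 1
    funext q
    simp only [pathEval_cons, ← map_smul, ← map_sum]
    congr 1
    funext q'
    simp only [Finset.sum_apply, Pi.smul_apply, Finset.smul_sum, Pi.mul_apply, Matrix.mul_apply,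
      Finset.sum_smul, smul_smul]
    rw [Finset.sum_comm]
    simp only [mul_comm]

/-- Substitution acts arrow by arrow and keeps endpoints, so it commutes with cutting a path. This
is what makes the substitution compatible with Δ. -/
theorem pathEval_pathSplits {a b : V} (p : Quiver.Path a b)
    (F : ∀ c : V, Quiver.Path a c → Quiver.Path c b → M) :
    (pathEval T p fun q => ((pathSplits q).map fun s => F s.1 s.2.1 s.2.2).sum) =
      ((pathSplits p).map fun s =>
        pathEval T s.2.1 fun u => pathEval T s.2.2 fun v => F s.1 u v).sum := by
  induction p with
  | nil => simp [pathSplits, pathEval_nil]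
  | cons p e ih =>
    rename_i b c
    have h := ih fun v s t => ∑ d : b ⟶ c, T b c d e • F v s (t.cons d)
    simp only [pathSplits, List.map_append, List.map_map, List.map_cons, List.map_nil,
      List.sum_append, List.sum_cons, List.sum_nil, add_zero, Function.comp_def, pathEval_cons,
      pathEval_nil] at h ⊢
    rw [← h, ← map_add]
    congr 1
    funext q
    simp only [Pi.add_apply, smul_add, Finset.sum_add_distrib]
    congr 1
    induction pathSplits q with
    | nil => simp
    | cons s l ih => simp [smul_add, Finset.sum_add_distrib, ih]

variable (n : ℕ)

/-- The endomorphism which replaces every arrow by a linear combination of parallel arrows, as a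
linear map. -/
noncomputable def arrowSubstitutionLinear :
    TruncPathCoalgebra k V n →ₗ[k] TruncPathCoalgebra k V n :=
  (basis k V n).constr k fun p => pathEval T p.path (ofPath k n)

theorem arrowSubstitutionLinear_ofPath {a b : V} (p : Quiver.Path a b) (hp : p.length ≤ n) :
    arrowSubstitutionLinear T n (ofPath k n p) = pathEval T p (ofPath k n) := by
  rw [ofPath, dif_pos hp, arrowSubstitutionLinear, Module.Basis.constr_basis]

/-- The coalgebra endomorphism which replaces every arrow by a linear combination of parallel
arrows. -/
noncomputable def arrowSubstitution : TruncPathCoalgebra k V n →ₗc[k] TruncPathCoalgebra k V n where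
  __ := arrowSubstitutionLinear T n
  counit_comp := by
    refine linearMap_ext_ofPath k n fun a b p hp => ?_
    rw [LinearMap.comp_apply, counit_ofPath k n p hp, arrowSubstitutionLinear_ofPath T n p hp,
      map_pathEval]
    cases p with
    | nil => rw [pathEval_nil, counit_vertex]; rfl
    | cons p e =>
      rw [pathEval_congr T (H := 0), map_zero, if_neg (by simp)]
      intro q hq
      rw [counit_ofPath k n q (by omega), hq, if_neg (by simp)]
      rfl
  map_comp_comul := by
    refine linearMap_ext_ofPath k n fun a b p hp => ?_
    rw [LinearMap.comp_apply, LinearMap.comp_apply, arrowSubstitutionLinear_ofPath T n p hp,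
      map_pathEval, comul_ofPath k n p hp,
      pathEval_congr T p fun q hq => comul_ofPath k n q (by omega),
      pathEval_pathSplits T p fun c u v => ofPath k n u ⊗ₜ[k] ofPath k n v, map_list_sum,
      List.map_map]
    refine congrArg List.sum (List.map_congr_left fun s hs => ?_)
    have hl := length_add_of_mem_pathSplits p s hs
    rw [Function.comp_apply, TensorProduct.map_tmul,
      arrowSubstitutionLinear_ofPath T n s.2.1 (by omega),
      arrowSubstitutionLinear_ofPath T n s.2.2 (by omega)]
    refine (map_pathEval T ((TensorProduct.mk k _ _).flip (pathEval T s.2.2 (ofPath k n)))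
      s.2.1 (ofPath k n)).trans ?_
    congr 1
    funext u
    exact map_pathEval T (TensorProduct.mk k _ _ (ofPath k n u)) s.2.2 (ofPath k n)

theorem arrowSubstitution_ofPath {a b : V} (p : Quiver.Path a b) (hp : p.length ≤ n) :
    arrowSubstitution T n (ofPath k n p) = pathEval T p (ofPath k n) :=
  arrowSubstitutionLinear_ofPath T n p hp

theorem arrowSubstitution_comp :
    (arrowSubstitution S n).comp (arrowSubstitution T n) = arrowSubstitution (S * T) n := by
  refine coalgHom_ext_ofPath n fun a b p hp => ?_
  rw [CoalgHom.comp_apply, arrowSubstitution_ofPath T n p hp,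
    arrowSubstitution_ofPath (S * T) n p hp, ← pathEval_pathEval]
  refine (map_pathEval T (arrowSubstitutionLinear S n) p (ofPath k n)).trans ?_
  exact pathEval_congr T p fun q hq => arrowSubstitution_ofPath S n q (by omega)

variable [∀ s t : V, DecidableEq (s ⟶ t)]

theorem arrowSubstitution_one :
    arrowSubstitution (1 : ∀ s t : V, Matrix (s ⟶ t) (s ⟶ t) k) n = CoalgHom.id k _ := by
  refine coalgHom_ext_ofPath n fun a b p hp => ?_
  rw [arrowSubstitution_ofPath _ n p hp, pathEval_one, CoalgHom.id_apply]

/-- The automorphism defined by invertible linear substitutions of the arrows. -/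
noncomputable def arrowSubstitutionEquiv (u : ArrowUnits k V) : truncAut k V n :=
  CoalgEquiv.ofCoalgHom (arrowSubstitution u.1 n) (arrowSubstitution (u⁻¹).1 n)
    (by rw [arrowSubstitution_comp, Units.mul_inv, arrowSubstitution_one])
    (by rw [arrowSubstitution_comp, Units.inv_mul, arrowSubstitution_one])

theorem arrowSubstitutionEquiv_ofPath (u : ArrowUnits k V) {a b : V} (p : Quiver.Path a b)
    (hp : p.length ≤ n) :
    arrowSubstitutionEquiv n u (ofPath k n p) = pathEval u.1 p (ofPath k n) :=
  arrowSubstitution_ofPath u.1 n p hp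

theorem toArrowUnits_surjective (hn : 1 ≤ n) : Function.Surjective (toArrowUnits k V n hn) := by
  intro u
  refine ⟨⟨arrowSubstitutionEquiv n u, (mem_coalgAutZero_iff k n _).2 fun i =>
    arrowSubstitutionEquiv_ofPath n u .nil (Nat.zero_le _)⟩, ?_⟩
  ext s t e d
  rw [toArrowUnits_apply, arrowMatrix_apply,
    arrowSubstitutionEquiv_ofPath n u d.toPath (by simpa using hn), pathEval_toPath, map_sum]
  simp only [map_smul, smul_eq_mul]
  rw [Finset.sum_congr rfl fun c _ => by
    rw [coeff_ofPath k n e.toPath c.toPath (by simpa using hn)], Finset.sum_eq_single e]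
  · rw [pathDelta_self, mul_one]
  · intro c _ hc
    rw [pathDelta_toPath, if_neg hc.symm, mul_zero]
  · exact fun h => absurd (Finset.mem_univ e) h

end LinearSubstitution

/-! ### Relabelling paths realizes every automorphism of the quiver. -/

section Relabelling

theorem pathSplits_mapPath (φ : V ⥤q V) {a b : V} (p : Quiver.Path a b) :
    pathSplits (φ.mapPath p) = (pathSplits p).map fun s =>
      ⟨φ.obj s.1, φ.mapPath s.2.1, φ.mapPath s.2.2⟩ := by
  induction p with
  | nil => rfl
  | cons p e ih => simp [pathSplits, ih, Function.comp_def]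

theorem length_mapPath (φ : V ⥤q V) {a b : V} (p : Quiver.Path a b) :
    (φ.mapPath p).length = p.length := by
  induction p with
  | nil => rfl
  | cons p e ih => simp [ih]

variable (n : ℕ) (φ : V ⥤q V)

/-- The action of an endomorphism of the quiver on the truncated paths. -/
def TruncPath.map (p : TruncPath V n) : TruncPath V n :=
  ⟨φ.obj p.src, φ.obj p.tgt, φ.mapPath p.path, by rw [length_mapPath]; exact p.length_le⟩

/-- Bijectivity on the arrows leaving each vertex propagates to the paths leaving it, as for
coverings. -/
theorem TruncPath.map_bijective (hobj : Function.Bijective φ.obj)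
    (hstar : ∀ a, Function.Bijective (φ.star a)) : Function.Bijective (TruncPath.map n φ) := by
  have hpath := φ.pathStar_bijective hstar
  constructor
  · rintro ⟨a, b, p, hp⟩ ⟨c, d, q, hq⟩ h
    obtain rfl : a = c := hobj.1 (congrArg TruncPath.src h)
    have e : φ.pathStar a ⟨b, p⟩ = φ.pathStar a ⟨d, q⟩ := by
      simp only [TruncPath.map, TruncPath.mk.injEq, true_and] at h
      rw [Prefunctor.pathStar_apply, Prefunctor.pathStar_apply]
      exact Sigma.ext h.1 (by simpa using h.2)
    cases (hpath a).1 e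
    rfl
  · rintro ⟨c, d, q, hq⟩
    obtain ⟨a, rfl⟩ := hobj.2 c
    obtain ⟨⟨b, p⟩, hp⟩ := (hpath a).2 ⟨d, q⟩
    rw [Prefunctor.pathStar_apply] at hp
    cases hp
    exact ⟨⟨a, b, p, by rwa [length_mapPath] at hq⟩, rfl⟩

variable (k)

/-- The linear map which relabels the paths. -/
noncomputable def relabelLinear : TruncPathCoalgebra k V n →ₗ[k] TruncPathCoalgebra k V n :=
  (basis k V n).constr k fun p => ofPath k n (φ.mapPath p.path)

theorem relabelLinear_ofPath {a b : V} (p : Quiver.Path a b) (hp : p.length ≤ n) :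
    relabelLinear k n φ (ofPath k n p) = ofPath k n (φ.mapPath p) := by
  rw [ofPath, dif_pos hp, relabelLinear, Module.Basis.constr_basis]

/-- The coalgebra endomorphism which relabels the paths. -/
noncomputable def relabel : TruncPathCoalgebra k V n →ₗc[k] TruncPathCoalgebra k V n where
  __ := relabelLinear k n φ
  counit_comp := by
    refine linearMap_ext_ofPath k n fun a b p hp => ?_
    rw [LinearMap.comp_apply, relabelLinear_ofPath k n φ p hp, counit_ofPath k n p hp,
      counit_ofPath k n _ (by rwa [length_mapPath]), length_mapPath]
  map_comp_comul := by
    refine linearMap_ext_ofPath k n fun a b p hp => ?_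
    rw [LinearMap.comp_apply, LinearMap.comp_apply, relabelLinear_ofPath k n φ p hp,
      comul_ofPath k n p hp, comul_ofPath k n _ (by rwa [length_mapPath]), pathSplits_mapPath,
      map_list_sum, List.map_map, List.map_map]
    refine congrArg List.sum (List.map_congr_left fun s hs => ?_)
    have hl := length_add_of_mem_pathSplits p s hs
    rw [Function.comp_apply, Function.comp_apply, TensorProduct.map_tmul,
      relabelLinear_ofPath k n φ s.2.1 (by omega), relabelLinear_ofPath k n φ s.2.2 (by omega)]

theorem relabel_bijective (hobj : Function.Bijective φ.obj)
    (hstar : ∀ a, Function.Bijective (φ.star a)) : Function.Bijective (relabel k n φ) := by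
  let E := (basis k V n).equiv (basis k V n)
    (Equiv.ofBijective _ (TruncPath.map_bijective n φ hobj hstar))
  have h : relabelLinear k n φ = E.toLinearMap := by
    refine (basis k V n).ext fun p => ?_
    rw [relabelLinear, Module.Basis.constr_basis, LinearEquiv.coe_coe, Module.Basis.equiv_apply,
      basis_eq_ofPath]
    rfl
  have h' : ⇑(relabel k n φ) = E := by
    funext x
    exact LinearMap.congr_fun h x
  rw [h']
  exact E.bijective

theorem toQuiverAut_surjective [∀ s t : V, Finite (s ⟶ t)] (hn : 1 ≤ n) :
    Function.Surjective (toQuiverAut k V n hn) := by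
  rintro ⟨σ, hσ⟩
  -- These bijections are arbitrary and need not be compatible with composition of permutations:
  -- surjectivity needs no homomorphic section.
  let ε : ∀ s t : V, (s ⟶ t) ≃ (σ s ⟶ σ t) := fun s t => (hσ s t).some
  let φ : V ⥤q V := { obj := σ, map := fun {s t} e => ε s t e }
  have hstar : ∀ a, Function.Bijective (φ.star a) := by
    intro a
    constructor
    · rintro ⟨b, e⟩ ⟨c, d⟩ h
      have hbc : b = c := σ.injective (congrArg Sigma.fst h)
      subst hbc
      have : ε a b e = ε a b d := eq_of_heq (Sigma.mk.inj h).2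
      rw [(ε a b).injective this]
    · rintro ⟨c, d⟩
      obtain ⟨b, rfl⟩ := σ.surjective c
      exact ⟨⟨b, (ε a b).symm d⟩, Sigma.ext rfl (heq_of_eq ((ε a b).apply_symm_apply d))⟩
  refine ⟨CoalgEquiv.ofBijective (relabel_bijective k n φ σ.bijective hstar), ?_⟩
  apply Subtype.ext
  ext i
  change vertexMap _ i = σ i
  rw [vertexMap_eq_iff, CoalgEquiv.ofBijective_apply]
  exact relabelLinear_ofPath k n φ .nil (Nat.zero_le _)

end Relabelling

end TruncPathCoalgebra

namespace TruncPathCoalgebra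

variable {k : Type*} [Field k] {V : Type*} [Quiver V]

/-! ### The solvability criteria. -/

section Solvability

theorem _root_.Group.isSolvable_iff_of_surjective {G H : Type*} [Group G] [Group H] (f : G →* H)
    (hf : Function.Surjective f) :
    Group.IsSolvable G ↔ Group.IsSolvable f.ker ∧ Group.IsSolvable H := by
  refine ⟨fun _ => ⟨inferInstance, Group.isSolvable_of_surjective hf⟩, fun ⟨h1, h2⟩ => ?_⟩
  exact Group.isSolvable_of_ker_le_range f.ker.subtype f (by simp)

theorem isSolvable_truncAut_iff [∀ s t : V, Finite (s ⟶ t)] {n : ℕ} (hn : 1 ≤ n) :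
    Group.IsSolvable (truncAut k V n) ↔
      Group.IsSolvable (truncAutZero k V n) ∧ Group.IsSolvable (quiverAut V) := by
  rw [Group.isSolvable_iff_of_surjective _ (toQuiverAut_surjective k n hn), ker_toQuiverAut]

variable [∀ s t : V, Fintype (s ⟶ t)] [∀ s t : V, DecidableEq (s ⟶ t)]

/-- The right-hand side is independent of n, which is why solvability for one n and for all n agree.
-/
theorem isSolvable_truncAutZero_iff {n : ℕ} (hn : 1 ≤ n) :
    Group.IsSolvable (truncAutZero k V n) ↔ Group.IsSolvable (ArrowUnits k V) := by
  rw [Group.isSolvable_iff_of_surjective _ (toArrowUnits_surjective n hn)]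
  exact and_iff_right (isSolvable_ker_toArrowUnits hn)

variable (k)

/-- All blocks have size at most one, so the group is commutative. -/
theorem isSolvable_arrowUnits_of_isSchurian (h : IsSchurian V) :
    Group.IsSolvable (ArrowUnits k V) := by
  refine Group.isSolvable_of_comm fun u v => ?_
  ext s t e d
  have := h s t
  have : Unique (s ⟶ t) := uniqueOfSubsingleton e
  change ((u.1 s t) * (v.1 s t)) e d = ((v.1 s t) * (u.1 s t)) e d
  rw [Matrix.mul_apply, Matrix.mul_apply, Fintype.sum_subsingleton _ e,
    Fintype.sum_subsingleton _ e, Subsingleton.elim d e, mul_comm]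

theorem isSchurian_of_isSolvable_arrowUnits (hk : 3 < ENat.card k)
    (h : Group.IsSolvable (ArrowUnits k V)) : IsSchurian V := by
  classical
  intro s t
  by_contra hst
  rw [not_subsingleton_iff_nontrivial] at hst
  let π : (∀ s t : V, Matrix (s ⟶ t) (s ⟶ t) k) →* Matrix (s ⟶ t) (s ⟶ t) k :=
    { toFun := fun M => M s t, map_one' := rfl, map_mul' := fun _ _ => rfl }
  let ι : Matrix (s ⟶ t) (s ⟶ t) k →* ∀ s t : V, Matrix (s ⟶ t) (s ⟶ t) k :=
    (MonoidHom.mulSingle (fun s => ∀ t : V, Matrix (s ⟶ t) (s ⟶ t) k) s).comp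
      (MonoidHom.mulSingle (fun t => Matrix (s ⟶ t) (s ⟶ t) k) t)
  -- Extension by identity blocks is a multiplicative section of the projection, so units lift and
  -- the GL at (s, t) is a quotient of `ArrowUnits`.
  have hπ : ∀ M, π (ι M) = M := fun M => by simp [π, ι]
  refine not_isSolvable_units_matrix k hk (ι := (s ⟶ t))
    (Group.isSolvable_of_surjective (f := Units.map π) fun u => ⟨Units.map ι u, ?_⟩)
  exact Units.ext (hπ u.1)

end Solvability

end TruncPathCoalgebra

theorem theorem3p6 (k : Type*) [Field k] (V : Type*) [Quiver V]
    [Finite V] [∀ s t : V, Finite (s ⟶ t)] :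
    -- valid over every field
    (((∃ n, 2 ≤ n ∧ Group.IsSolvable (truncAutZero k V n)) ↔
        ∀ n, 2 ≤ n → Group.IsSolvable (truncAutZero k V n)) ∧
      (IsSchurian V → ∀ n, 2 ≤ n → Group.IsSolvable (truncAutZero k V n)) ∧
      ((∃ n, 2 ≤ n ∧ Group.IsSolvable (truncAut k V n)) ↔
        ∀ n, 2 ≤ n → Group.IsSolvable (truncAut k V n)) ∧
      (IsSchurian V ∧ Group.IsSolvable (quiverAut V) →
        ∀ n, 2 ≤ n → Group.IsSolvable (truncAut k V n)) ∧
      ((∃ n, 2 ≤ n ∧ Group.IsSolvable (truncAut k V n)) → Group.IsSolvable (quiverAut V))) ∧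
    -- the equivalences, for a field with more than three elements
    (3 < ENat.card k →
      ((∃ n, 2 ≤ n ∧ Group.IsSolvable (truncAutZero k V n)) ↔ IsSchurian V) ∧
      (IsSchurian V ↔ ∀ n, 2 ≤ n → Group.IsSolvable (truncAutZero k V n)) ∧
      ((∃ n, 2 ≤ n ∧ Group.IsSolvable (truncAut k V n)) ↔
        IsSchurian V ∧ Group.IsSolvable (quiverAut V)) ∧
      (IsSchurian V ∧ Group.IsSolvable (quiverAut V) ↔
        ∀ n, 2 ≤ n → Group.IsSolvable (truncAut k V n))) := by
  classical
  have : ∀ s t : V, Fintype (s ⟶ t) := fun s t => Fintype.ofFinite _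
  have h0 : ∀ n, 2 ≤ n → (Group.IsSolvable (truncAutZero k V n) ↔
      Group.IsSolvable (TruncPathCoalgebra.ArrowUnits k V)) := fun n hn =>
    TruncPathCoalgebra.isSolvable_truncAutZero_iff (by omega)
  have h1 : ∀ n, 2 ≤ n → (Group.IsSolvable (truncAut k V n) ↔
      Group.IsSolvable (TruncPathCoalgebra.ArrowUnits k V) ∧ Group.IsSolvable (quiverAut V)) :=
    fun n hn => by
      rw [TruncPathCoalgebra.isSolvable_truncAut_iff (by omega), h0 n hn]
  have hex : ∀ {P : ℕ → Prop} {A : Prop}, (∀ n, 2 ≤ n → (P n ↔ A)) →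
      ((∃ n, 2 ≤ n ∧ P n) ↔ A) := fun h =>
    ⟨fun ⟨n, hn, hP⟩ => (h n hn).1 hP, fun hA => ⟨2, le_rfl, (h 2 le_rfl).2 hA⟩⟩
  have hall : ∀ {P : ℕ → Prop} {A : Prop}, (∀ n, 2 ≤ n → (P n ↔ A)) →
      ((∀ n, 2 ≤ n → P n) ↔ A) := fun h =>
    ⟨fun hP => (h 2 le_rfl).1 (hP 2 le_rfl), fun hA n hn => (h n hn).2 hA⟩
  -- Every quantified statement becomes its n-free criterion, so the comparisons between some n and
  -- all n become reflexive.
  rw [hex h0, hall h0, hex h1, hall h1]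
  have hS := TruncPathCoalgebra.isSolvable_arrowUnits_of_isSchurian (V := V) k
  refine ⟨⟨Iff.rfl, hS, Iff.rfl, And.imp_left hS, And.right⟩, fun hk => ?_⟩
  have hS' : Group.IsSolvable (TruncPathCoalgebra.ArrowUnits k V) ↔ IsSchurian V :=
    ⟨TruncPathCoalgebra.isSchurian_of_isSolvable_arrowUnits k hk, hS⟩
  rw [hS']
  exact ⟨Iff.rfl, Iff.rfl, Iff.rfl, Iff.rfl⟩
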